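/- Let $p\in\mathbb{C}[z]$ be a monic cubic polynomial with three distinct roots. One step of the Gauss–Seidel variant of the Weierstrass method for $p$ is the following operation on $\mathbb{C}^3$: given $(z_1,z_2,z_3)$, for $i=1,2,3$ in this order, replace $$z_i \;\leftarrow\; z_i-\frac{p(z_i)}{\prod_{j\neq i}(z_i-z_j)},$$ where each replacement uses the current values of all coordinates (so already updated values are used for later coordinates); the step is well defined at $(z_1,z_2,z_3)$ if none of the three denominators that occur vanishes. Denote the resulting partial map by $\operatorname{GSW}_p\colon\mathbb{C}^3\dashrightarrow\mathbb{C}^3$. Then $\operatorname{GSW}_p$ has an orbit that goes to infinity in every coordinate: there is an infinite sequence $z^{(0)},z^{(1)},z^{(2)},\dots$ in $\mathbb{C}^3$ such that, for every $k\ge 0$, $\operatorname{GSW}_p$ is well defined at $z^{(k)}$ and $z^{(k+1)}=\operatorname{GSW}_p(z^{(k)})$, and such that $|z^{(k)}_i|\to\infty$ as $k\to\infty$ for each $i\in\{1,2,3\}$. -/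

import Mathlib

open Polynomial

/-- The Weierstrass update of the `i`-th coordinate of the approximation vector `z`:
`z_i - p(z_i) / ∏_{j ≠ i} (z_i - z_j)`.
It is meaningful only where the denominator does not vanish, see `gswDefinedAt`. -/
noncomputable def weierstrassUpdate {n : ℕ} (p : ℂ[X]) (z : Fin n → ℂ) (i : Fin n) : ℂ :=
  z i - p.eval (z i) / ∏ j ∈ Finset.univ.erase i, (z i - z j)

/-- The approximation vector inside one Gauss–Seidel sweep after the first `k` coordinates have
been overwritten, in order, by their Weierstrass updates; each update uses the current
(already overwritten) values. -/
noncomputable def gswStage {n : ℕ} (p : ℂ[X]) (z : Fin n → ℂ) : ℕ → (Fin n → ℂ)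
  | 0 => z
  | k + 1 =>
    if h : k < n then
      Function.update (gswStage p z k) ⟨k, h⟩ (weierstrassUpdate p (gswStage p z k) ⟨k, h⟩)
    else gswStage p z k

/-- One step of the Gauss–Seidel variant of the Weierstrass method: a full sweep over all `n`
coordinates. -/
noncomputable def gsw {n : ℕ} (p : ℂ[X]) (z : Fin n → ℂ) : Fin n → ℂ :=
  gswStage p z n

/-- The Gauss–Seidel Weierstrass step is well defined at `z`: no division by zero occurs in the
sweep, i.e. when the `i`-th coordinate is about to be updated, it differs from every other current
coordinate. -/
def gswDefinedAt {n : ℕ} (p : ℂ[X]) (z : Fin n → ℂ) : Prop :=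
  ∀ i j : Fin n, j ≠ i → gswStage p z i i ≠ gswStage p z i j

/-- `z 0, z 1, z 2, …` is an infinite forward orbit of the Gauss–Seidel Weierstrass method, along
which every step is well defined. -/
def IsGSWOrbit {n : ℕ} (p : ℂ[X]) (z : ℕ → Fin n → ℂ) : Prop :=
  ∀ k : ℕ, gswDefinedAt p (z k) ∧ z (k + 1) = gsw p (z k)

/-!
List the coordinates in the order in which the sweeps compute them: `w 0, …, w (n - 1)` are the
initial values, and `w (m + n)` is the update of `w m` against `w (m + 1), …, w (m + n - 1)`. The
method then is the scalar recurrence `∏ (w m - w (m + k)) = p(w m)`, `1 ≤ k ≤ n`. Its leading part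
for `|w m| → ∞` is solved by `w m = μ ^ m` as soon as `∏ (1 - μ ^ k)` is the leading coefficient of
`p`. Insert `w m = μ ^ (N + m) + f m` with `|μ| > 1` and `f` bounded, and divide by
`μ ^ (n (N + m))`: up to terms of order `μ ^ (-(N + m))`, the recurrence expresses `f m` as a
constant plus `∑ (1 - μ ^ k)⁻¹ f (m + k)` divided by `∑ ((1 - μ ^ k)⁻¹ - 1)`. With the recurrence
read backwards in this way, `f` is a fixed point of a self-map of a ball of bounded sequences, and
this map is a contraction for large `N` provided `∑ |1 - μ ^ k|⁻¹ < |∑ ((1 - μ ^ k)⁻¹ - 1)|`. For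
monic cubics, `μ ≈ 1.299 + 0.366 i` with `(1 - μ) (1 - μ ^ 2) (1 - μ ^ 3) = 1` has this property.
-/

open Filter Topology
open scoped NNReal

section Contraction

open scoped UniformConvergence

variable {T ι E 𝕜 : Type*} [Fintype ι]

theorem exists_forall_eq_of_lipschitzWith {X : Type*} [MetricSpace X] [CompleteSpace X]
    [BoundedSpace X] [Nonempty X] {K : ℝ≥0} (hK : K < 1) (σ : T → ι → T) {Φ : T → (ι → X) → X}
    (hΦ : ∀ t, LipschitzWith K (Φ t)) :
    ∃ f : T → X, ∀ t, f t = Φ t fun i => f (σ t i) := by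
  let F : (T →ᵤ X) → (T →ᵤ X) := fun f =>
    UniformFun.ofFun fun t => Φ t fun i => UniformFun.toFun f (σ t i)
  have hF : ContractingWith K F := by
    refine ⟨hK, LipschitzWith.of_dist_le_mul fun f g => ?_⟩
    refine (UniformFun.dist_le (by positivity)).2 fun t => ((hΦ t).dist_le_mul _ _).trans ?_
    gcongr
    exact (dist_pi_le_iff dist_nonneg).2 fun i => (UniformFun.dist_le dist_nonneg).1 le_rfl _
  exact ⟨UniformFun.toFun (hF.fixedPoint F), fun t =>
    congrFun (congrArg UniformFun.toFun hF.fixedPoint_isFixedPt.symm) t⟩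

theorem exists_forall_mem_eq_of_lipschitzOnWith [MetricSpace E] {s : Set E} (hs : IsComplete s)
    (hb : Bornology.IsBounded s) (hne : s.Nonempty) {K : ℝ≥0} (hK : K < 1) (σ : T → ι → T)
    {Φ : T → (ι → E) → E} (hmaps : ∀ t, Set.MapsTo (Φ t) (Set.univ.pi fun _ => s) s)
    (hΦ : ∀ t, LipschitzOnWith K (Φ t) (Set.univ.pi fun _ => s)) :
    ∃ f : T → E, (∀ t, f t ∈ s) ∧ ∀ t, f t = Φ t fun i => f (σ t i) := by
  have := hs.completeSpace_coe
  have := boundedSpace_val_set_iff.2 hb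
  have := hne.to_subtype
  have hmem (v : ι → s) : (fun i => (v i : E)) ∈ Set.univ.pi fun _ => s := fun i _ => (v i).2
  obtain ⟨f, hf⟩ := exists_forall_eq_of_lipschitzWith hK σ
    (Φ := fun t (v : ι → s) => (⟨Φ t fun i => v i, hmaps t (hmem v)⟩ : s))
    fun t => LipschitzWith.of_dist_le_mul fun v w => (hΦ t).dist_le_mul _ (hmem v) _ (hmem w)
  exact ⟨fun t => f t, fun t => (f t).2, fun t => congrArg Subtype.val (hf t)⟩

variable [NormedField 𝕜] [NormedAddCommGroup E] [NormedSpace 𝕜 E]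

theorem eventually_norm_smul_le_and_lipschitzOnWith_smul [ProperSpace 𝕜] {V : Type*}
    [PseudoMetricSpace V] {Q : 𝕜 × V → E} (hQ : LocallyLipschitz Q) {s : Set V} (hs : IsCompact s)
    {δ : ℝ≥0} (hδ : 0 < δ) :
    ∀ᶠ u in 𝓝 (0 : 𝕜), (∀ v ∈ s, ‖u • Q (u, v)‖ ≤ δ) ∧
      LipschitzOnWith δ (fun v => u • Q (u, v)) s := by
  have hcpt : IsCompact (Metric.closedBall (0 : 𝕜) 1 ×ˢ s) := (isCompact_closedBall _ _).prod hs
  obtain ⟨L, hL⟩ := hQ.locallyLipschitzOn.exists_lipschitzOnWith_of_compact hcpt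
  obtain ⟨M, hM⟩ := hcpt.exists_bound_of_continuousOn hQ.continuous.continuousOn
  have hsmall (C : ℝ) : ∀ᶠ u in 𝓝 (0 : 𝕜), ‖u‖ * C < δ := by
    refine (continuous_norm.mul continuous_const).continuousAt.eventually_lt_const ?_
    simpa using hδ
  filter_upwards [hsmall M, hsmall L, Metric.closedBall_mem_nhds (0 : 𝕜) one_pos]
    with u huM huL hu
  refine ⟨fun v hv => ?_, LipschitzOnWith.of_dist_le_mul fun v hv w hw => ?_⟩
  · rw [norm_smul]
    exact (by gcongr; exact hM _ ⟨hu, hv⟩ : ‖u‖ * ‖Q (u, v)‖ ≤ ‖u‖ * M).trans huM.le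
  · have hLvw : dist (Q (u, v)) (Q (u, w)) ≤ L * dist v w := by
      simpa [Prod.dist_eq] using hL.dist_le_mul (u, v) ⟨hu, hv⟩ (u, w) ⟨hu, hw⟩
    calc dist (u • Q (u, v)) (u • Q (u, w)) = ‖u‖ * dist (Q (u, v)) (Q (u, w)) := dist_smul₀ ..
      _ ≤ ‖u‖ * L * dist v w := by rw [mul_assoc]; gcongr
      _ ≤ δ * dist v w := by gcongr

theorem exists_bound_eventually_exists_forall_eq_add_smul [ProperSpace 𝕜] [ProperSpace E]
    {K : ℝ≥0} (hK : K < 1) (σ : ℕ → ι → ℕ) {A : (ι → E) → E} (hA : LipschitzWith K A)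
    {Q : 𝕜 × (ι → E) → E} (hQ : LocallyLipschitz Q) {u : ℕ → 𝕜} (hu : Tendsto u atTop (𝓝 0)) :
    ∃ R : ℝ, ∀ᶠ N in atTop, ∃ f : ℕ → E, (∀ m, ‖f m‖ ≤ R) ∧ ∀ m,
      f m = A (fun i => f (σ m i)) + u (N + m) • Q (u (N + m), fun i => f (σ m i)) := by
  obtain ⟨_, hKδ, hδ1⟩ := exists_between hK
  obtain ⟨δ, hδ, rfl⟩ := exists_pos_add_of_lt' hKδ
  set R : ℝ := (‖A 0‖ + δ) / (1 - K)
  have hK' : 0 < 1 - (K : ℝ) := sub_pos.2 (mod_cast hK)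
  have hR : K * R + ‖A 0‖ + δ = R := by simp only [R]; field_simp; ring
  have hR0 : 0 ≤ R := by positivity
  have hball : (Set.univ.pi fun _ : ι => Metric.closedBall (0 : E) R) = Metric.closedBall 0 R :=
    (closedBall_pi _ hR0).symm
  obtain ⟨N₀, hN₀⟩ := eventually_atTop.1 <| hu.eventually <|
    eventually_norm_smul_le_and_lipschitzOnWith_smul hQ
      (isCompact_closedBall (0 : ι → E) R) hδ
  refine ⟨R, eventually_atTop.2 ⟨N₀, fun N hN => ?_⟩⟩
  have hpert (m : ℕ) := hN₀ (N + m) (by lia)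
  suffices hfix : ∃ f : ℕ → E, (∀ m, f m ∈ Metric.closedBall 0 R) ∧ ∀ m,
      f m = A (fun i => f (σ m i)) + u (N + m) • Q (u (N + m), fun i => f (σ m i)) by
    simpa only [mem_closedBall_zero_iff] using hfix
  refine exists_forall_mem_eq_of_lipschitzOnWith
    (Φ := fun m v => A v + u (N + m) • Q (u (N + m), v))
    Metric.isClosed_closedBall.isComplete Metric.isBounded_closedBall
    (Metric.nonempty_closedBall.2 hR0) hδ1 σ (fun m v hv => ?_) fun m => ?_
  · rw [hball] at hv
    rw [mem_closedBall_zero_iff] at hv ⊢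
    have hAv : ‖A v‖ ≤ K * R + ‖A 0‖ := by
      have hAv0 : ‖A v - A 0‖ ≤ K * ‖v‖ := by simpa using hA.norm_sub_le v 0
      have hKv : K * ‖v‖ ≤ K * R := by gcongr
      linarith [norm_le_norm_add_norm_sub' (A v) (A 0)]
    linarith [norm_add_le (A v) (u (N + m) • Q (u (N + m), v)),
      (hpert m).1 v (mem_closedBall_zero_iff.2 hv)]
  · rw [hball]
    exact hA.lipschitzOnWith.add (hpert m).2

end Contraction

section ReducedEquation

variable {ι κ 𝕜 : Type*} [Fintype ι] [Fintype κ] [NontriviallyNormedField 𝕜]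

theorem prod_mul_add_eq_pow_card_mul {F : Type*} [Field F] {x : F} (hx : x ≠ 0) {d : ι → F}
    (hd : ∀ i, d i ≠ 0) (a : ι → F) :
    ∏ i, (x * d i + a i) =
      x ^ Fintype.card ι * (∏ i, d i) * ∏ i, (1 + x⁻¹ * ((d i)⁻¹ * a i)) := by
  rw [← Finset.card_univ, ← Finset.prod_const, ← Finset.prod_mul_distrib, ← Finset.prod_mul_distrib]
  refine Finset.prod_congr rfl fun i _ => ?_
  have := hd i
  field_simp

theorem exists_contDiff_finset_prod_one_add_mul_eq (s : Finset ι) :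
    ∃ q : 𝕜 × (ι → 𝕜) → 𝕜, ContDiff 𝕜 1 q ∧ ∀ u e,
      ∏ i ∈ s, (1 + u * e i) = 1 + u * (∑ i ∈ s, e i + u * q (u, e)) := by
  classical
  induction s using Finset.induction_on with
  | empty => exact ⟨0, contDiff_const, by simp⟩
  | insert a s ha ih =>
    obtain ⟨q, hq, hprod⟩ := ih
    refine ⟨fun x => q x + x.2 a * ∑ i ∈ s, x.2 i + x.1 * x.2 a * q x, by fun_prop, fun u e => ?_⟩
    rw [Finset.prod_insert ha, Finset.sum_insert ha, hprod]
    ring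

theorem sum_mul_sub_eq_sum_sub_add_of_eq {F : Type*} [Field F] {c : ι → F}
    (hG : ∑ i, (c i - 1) ≠ 0) {r : κ → F} (hcard : Fintype.card κ = Fintype.card ι) {x ε : F}
    {y : ι → F} (h : x = ∑ i, c i / (∑ j, (c j - 1)) * y i + -(∑ j, r j) / (∑ j, (c j - 1))
      + ε / (∑ j, (c j - 1))) :
    ∑ i, c i * (x - y i) = ∑ j, (x - r j) + ε := by
  simp only [div_mul_eq_mul_div, ← Finset.sum_div, ← add_div] at h
  rw [eq_div_iff hG, Finset.sum_sub_distrib, Finset.sum_const, Finset.card_univ, nsmul_one] at h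
  simp only [mul_sub, Finset.sum_sub_distrib, ← Finset.sum_mul, Finset.sum_const,
    Finset.card_univ, hcard, nsmul_eq_mul]
  linear_combination h

theorem exists_contDiff_forall_prod_eq_prod {d : ι → 𝕜} (hd : ∀ i, d i ≠ 0)
    (hG : ∑ i, ((d i)⁻¹ - 1) ≠ 0) (r : κ → 𝕜) (hcard : Fintype.card κ = Fintype.card ι) :
    ∃ (b : 𝕜) (Q : 𝕜 × (Option ι → 𝕜) → 𝕜), ContDiff 𝕜 1 Q ∧ ∀ x ≠ 0, ∀ v : Option ι → 𝕜,
      v none = ∑ i, (d i)⁻¹ / (∑ j, ((d j)⁻¹ - 1)) * v (some i) + b + x⁻¹ * Q (x⁻¹, v) →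
      ∏ i, (x * d i + (v none - v (some i))) = (∏ i, d i) * ∏ j, (x + v none - r j) := by
  obtain ⟨q, hq, hprod⟩ := exists_contDiff_finset_prod_one_add_mul_eq (𝕜 := 𝕜) (.univ : Finset ι)
  obtain ⟨q', hq', hprod'⟩ := exists_contDiff_finset_prod_one_add_mul_eq (𝕜 := 𝕜) (.univ : Finset κ)
  set G := ∑ i, ((d i)⁻¹ - 1)
  let e (v : Option ι → 𝕜) (i : ι) : 𝕜 := (d i)⁻¹ * (v none - v (some i))
  let e' (v : Option ι → 𝕜) (j : κ) : 𝕜 := v none - r j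
  refine ⟨-(∑ j, r j) / G, fun y => (q' (y.1, e' y.2) - q (y.1, e y.2)) / G, ?_,
    fun x hx v hv => ?_⟩
  · simp only [e, e']
    fun_prop
  -- Divided by `x ^ n * ∏ i, d i`, both sides become products of factors `1 + O(x⁻¹)`; the
  -- equation for `v none` matches their first-order terms, with all higher ones collected in `Q`.
  have hlin : ∑ i, e v i + x⁻¹ * q (x⁻¹, e v) = ∑ j, e' v j + x⁻¹ * q' (x⁻¹, e' v) := by
    rw [← mul_div_assoc] at hv
    linear_combination sum_mul_sub_eq_sum_sub_add_of_eq hG hcard hv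
  calc ∏ i, (x * d i + (v none - v (some i)))
      = x ^ Fintype.card ι * (∏ i, d i) * ∏ i, (1 + x⁻¹ * e v i) :=
        prod_mul_add_eq_pow_card_mul hx hd _
    _ = (∏ i, d i) * (x ^ Fintype.card κ * (∏ _j : κ, 1) * ∏ j, (1 + x⁻¹ * e' v j)) := by
        rw [hprod, hprod', hlin, hcard]
        simp only [Finset.prod_const_one]
        ring
    _ = (∏ i, d i) * ∏ j, (x + v none - r j) := by
        simpa [e', add_sub_assoc] using congrArg ((∏ i, d i) * ·)
          (prod_mul_add_eq_pow_card_mul hx (fun _ => one_ne_zero) (e' v)).symm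

theorem lipschitzWith_sum_mul_add {F : Type*} [NormedField F] (c : ι → F) (g : ι → κ) (b : F) :
    LipschitzWith (∑ i, ‖c i‖₊) fun v : κ → F => ∑ i, c i * v (g i) + b := by
  refine LipschitzWith.of_dist_le_mul fun v w => ?_
  rw [dist_add_right]
  calc _ ≤ ∑ i, dist (c i * v (g i)) (c i * w (g i)) := dist_sum_sum_le ..
    _ = ∑ i, ‖c i‖ * dist (v (g i)) (w (g i)) := by simp only [← smul_eq_mul, dist_smul₀]
    _ ≤ ∑ i, ‖c i‖ * dist v w := by gcongr; exact dist_le_pi_dist ..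
    _ = _ := by push_cast; rw [Finset.sum_mul]

end ReducedEquation

section GeometricGrowth

variable {𝕜 : Type*} [NormedField 𝕜]

theorem one_sub_pow_succ_ne_zero {μ : 𝕜} (hμ : 1 < ‖μ‖) (k : ℕ) : 1 - μ ^ (k + 1) ≠ 0 := by
  refine fun h => (one_lt_pow₀ hμ k.succ_ne_zero).ne ?_
  rw [← norm_pow, ← sub_eq_zero.1 h, norm_one]

theorem pow_add_ne_pow_add_of_norm_le {μ : 𝕜} {f : ℕ → 𝕜} {R : ℝ} {N k : ℕ} (hμ : 1 < ‖μ‖)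
    (hf : ∀ m, ‖f m‖ ≤ R) (hN : 2 * R < ‖μ‖ ^ N * ‖1 - μ ^ k‖) (m : ℕ) :
    μ ^ (N + m) + f m ≠ μ ^ (N + (m + k)) + f (m + k) := by
  intro heq
  have hdiff : μ ^ (N + m) * (1 - μ ^ k) = f (m + k) - f m := by linear_combination heq
  have hle : ‖μ‖ ^ N * ‖1 - μ ^ k‖ ≤ 2 * R := by
    calc ‖μ‖ ^ N * ‖1 - μ ^ k‖ ≤ ‖μ‖ ^ (N + m) * ‖1 - μ ^ k‖ := by
          gcongr
          exacts [hμ.le, N.le_add_right m]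
      _ = ‖f (m + k) - f m‖ := by rw [← hdiff, norm_mul, norm_pow]
      _ ≤ 2 * R := by linarith [norm_sub_le (f (m + k)) (f m), hf m, hf (m + k)]
  exact hN.not_ge hle

theorem tendsto_pow_add_cobounded_of_norm_le {μ : 𝕜} {f : ℕ → 𝕜} {R : ℝ} (hμ : 1 < ‖μ‖)
    (hf : ∀ m, ‖f m‖ ≤ R) (N : ℕ) :
    Tendsto (fun m => μ ^ (N + m) + f m) atTop (Bornology.cobounded 𝕜) := by
  rw [← tendsto_norm_atTop_iff_cobounded]
  have hpow : Tendsto (fun m => ‖μ‖ ^ (N + m)) atTop atTop :=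
    (tendsto_pow_atTop_atTop_of_one_lt hμ).comp
      (tendsto_atTop_mono (fun m => m.le_add_left N) tendsto_id)
  refine tendsto_atTop_mono (fun m => ?_) (tendsto_atTop_add_const_right atTop (-R) hpow)
  rw [← norm_pow]
  linarith [norm_le_add_norm_add (μ ^ (N + m)) (f m), hf m]

end GeometricGrowth

/-- The ratio `μ` of a geometric sequence that solves the leading-order recurrence
`∏ₖ (w m - w (m + k)) = a * w m ^ n` and along which the linearised recurrence determines `w m`
from the `n` later terms by a contraction. -/
structure IsEscapeRatio (n : ℕ) (a μ : ℂ) : Prop where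
  one_lt_norm : 1 < ‖μ‖
  prod_eq : ∏ k : Fin n, (1 - μ ^ (k + 1 : ℕ)) = a
  sum_norm_lt :
    ∑ k : Fin n, ‖(1 - μ ^ (k + 1 : ℕ))⁻¹‖ < ‖∑ k : Fin n, ((1 - μ ^ (k + 1 : ℕ))⁻¹ - 1)‖

/-- The scalar form of an orbit of the Gauss–Seidel Weierstrass method in dimension `n`: the
coordinates in the order in which they are computed, each of them being the update of the one
computed `n` places earlier. -/
structure IsScalarOrbit (n : ℕ) (p : ℂ[X]) (w : ℕ → ℂ) : Prop where
  ne : ∀ m k, k + 1 < n → w m ≠ w (m + (k + 1))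
  prod_eq : ∀ m, ∏ k : Fin n, (w m - w (m + (k + 1))) = p.eval (w m)

theorem IsEscapeRatio.exists_bound_eventually_exists_prod_eq_eval {n : ℕ} {p : ℂ[X]} {μ : ℂ}
    (hμ : IsEscapeRatio n p.leadingCoeff μ) (hn : p.natDegree = n) :
    ∃ R : ℝ, ∀ᶠ N in atTop, ∃ f : ℕ → ℂ, (∀ m, ‖f m‖ ≤ R) ∧ ∀ m,
      ∏ k : Fin n, (μ ^ (N + m) + f m - (μ ^ (N + (m + (k + 1))) + f (m + (k + 1)))) =
        p.eval (μ ^ (N + m) + f m) := by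
  have hd (k : Fin n) := one_sub_pow_succ_ne_zero hμ.one_lt_norm k
  have hG := norm_pos_iff.1 ((Finset.sum_nonneg fun _ _ => norm_nonneg _).trans_lt hμ.sum_norm_lt)
  have hsplits := IsAlgClosed.splits p
  have hcard : Fintype.card p.roots = Fintype.card (Fin n) := by
    rw [Multiset.card_coe, ← hsplits.natDegree_eq_card_roots, hn, Fintype.card_fin]
  obtain ⟨b, Q, hQ, hsolves⟩ :=
    exists_contDiff_forall_prod_eq_prod hd hG (fun r : p.roots => (r : ℂ)) hcard
  set G := ∑ k : Fin n, ((1 - μ ^ (k + 1 : ℕ))⁻¹ - 1)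
  have hcontr : ∑ k : Fin n, ‖(1 - μ ^ (k + 1 : ℕ))⁻¹ / G‖₊ < 1 := by
    simp_rw [nnnorm_div, ← Finset.sum_div]
    rw [div_lt_one (nnnorm_pos.2 hG), ← NNReal.coe_lt_coe, NNReal.coe_sum]
    exact hμ.sum_norm_lt
  have hnull : Tendsto (fun m => (μ ^ m)⁻¹) atTop (𝓝 0) := by
    have hinv : ‖μ⁻¹‖ < 1 := norm_inv μ ▸ inv_lt_one_of_one_lt₀ hμ.one_lt_norm
    simpa only [inv_pow] using tendsto_pow_atTop_nhds_zero_of_norm_lt_one hinv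
  let σ (m : ℕ) (o : Option (Fin n)) : ℕ := o.elim m fun k => m + (k + 1)
  obtain ⟨R, hR⟩ := exists_bound_eventually_exists_forall_eq_add_smul hcontr σ
    (lipschitzWith_sum_mul_add _ some b) hQ.locallyLipschitz hnull
  refine ⟨R, hR.mono fun N ⟨f, hfR, hf⟩ => ⟨f, hfR, fun m => ?_⟩⟩
  have hμ0 : μ ≠ 0 := norm_pos_iff.1 (one_pos.trans hμ.one_lt_norm)
  have hprod := hsolves _ (pow_ne_zero (N + m) hμ0) (fun o => f (σ m o)) (hf m)
  have hroots (z : ℂ) : p.eval z = p.leadingCoeff * ∏ r : p.roots, (z - r) := by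
    rw [hsplits.eval_eq_prod_roots]
    exact congrArg (p.leadingCoeff * ·.prod) (p.roots.map_univ (z - ·)).symm
  rw [hroots, ← hμ.prod_eq]
  refine (Finset.prod_congr rfl fun k _ => ?_).trans hprod
  simp only [σ, Option.elim]
  ring

theorem IsEscapeRatio.exists_isScalarOrbit_tendsto {n : ℕ} {p : ℂ[X]} {μ : ℂ}
    (hμ : IsEscapeRatio n p.leadingCoeff μ) (hn : p.natDegree = n) :
    ∃ w : ℕ → ℂ, IsScalarOrbit n p w ∧ Tendsto w atTop (Bornology.cobounded ℂ) := by
  obtain ⟨R, hR⟩ := hμ.exists_bound_eventually_exists_prod_eq_eval hn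
  have hfar : ∀ᶠ N in atTop, ∀ k : Fin n, 2 * R < ‖μ‖ ^ N * ‖1 - μ ^ (k + 1 : ℕ)‖ :=
    eventually_all.2 fun k => ((tendsto_pow_atTop_atTop_of_one_lt hμ.one_lt_norm).atTop_mul_const
      (norm_pos_iff.2 (one_sub_pow_succ_ne_zero hμ.one_lt_norm k))).eventually_gt_atTop _
  obtain ⟨N, ⟨f, hfR, hf⟩, hN⟩ := (hR.and hfar).exists
  exact ⟨fun m => μ ^ (N + m) + f m,
    ⟨fun m k hk => pow_add_ne_pow_add_of_norm_le hμ.one_lt_norm hfR (hN ⟨k, by lia⟩) m, hf⟩,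
    tendsto_pow_add_cobounded_of_norm_le hμ.one_lt_norm hfR N⟩

section Sweep

variable {n : ℕ} {p : ℂ[X]} {w : ℕ → ℂ}

theorem prod_univ_erase_eq_prod_add_succ {M : Type*} [CommMonoid M] (i : Fin (n + 1))
    (f : Fin (n + 1) → M) : ∏ j ∈ Finset.univ.erase i, f j = ∏ k : Fin n, f (i + k.succ) := by
  have hne : Finset.univ.erase i = Finset.univ.image fun k : Fin n => i + k.succ := by
    ext j
    simp only [Finset.mem_erase, Finset.mem_univ, and_true, Finset.mem_image, true_and]
    refine ⟨fun hj => ?_, ?_⟩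
    · obtain ⟨k, hk⟩ := Fin.exists_succ_eq.2 (sub_ne_zero.2 hj)
      exact ⟨k, by rw [hk, add_sub_cancel]⟩
    · rintro ⟨k, rfl⟩
      simp
  rw [hne, Finset.prod_image]
  exact fun k _ l _ h => Fin.succ_injective _ (add_left_cancel h)

/-- The approximation vector inside the sweep that starts from the terms `w m, …, w (m + n - 1)`
of a sequence, when the first `k` coordinates have been overwritten by the terms that follow. -/
def shiftWindow (w : ℕ → ℂ) (n m k : ℕ) (j : Fin n) : ℂ :=
  if j < k then w (m + n + j) else w (m + j)

theorem shiftWindow_self (m : ℕ) (i : Fin n) : shiftWindow w n m i i = w (m + i) := by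
  simp [shiftWindow]

theorem shiftWindow_add_succ (m : ℕ) (i : Fin (n + 1)) (k : Fin n) :
    shiftWindow w (n + 1) m i (i + k.succ) = w (m + i + (k + 1)) := by
  rcases lt_or_ge (i + (k + 1) : ℕ) (n + 1) with h | h
  · have hval : ((i + k.succ : Fin (n + 1)) : ℕ) = i + (k + 1) := by
      rw [Fin.val_add_eq_ite, Fin.val_succ, if_neg h.not_ge]
    rw [shiftWindow, if_neg (by lia), hval, add_assoc]
  · have hval : ((i + k.succ : Fin (n + 1)) : ℕ) = i + (k + 1) - (n + 1) := by
      rw [Fin.val_add_eq_ite, Fin.val_succ, if_pos h]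
    rw [shiftWindow, if_pos (by lia), hval]
    congr 1
    lia

theorem update_shiftWindow (m : ℕ) (i : Fin n) :
    Function.update (shiftWindow w n m i) i (w (m + n + i)) = shiftWindow w n m (i + 1) := by
  ext j
  rcases eq_or_ne j i with rfl | hji
  · simp [shiftWindow]
  · have hlt : (j : ℕ) < i + 1 ↔ (j : ℕ) < i := by have := Fin.val_ne_of_ne hji; lia
    simp [shiftWindow, hji, hlt]

theorem shiftWindow_of_le {k : ℕ} (hk : n ≤ k) (m : ℕ) (j : Fin n) :
    shiftWindow w n m k j = w (m + n + j) :=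
  if_pos (j.2.trans_le hk)

namespace IsScalarOrbit

theorem weierstrassUpdate_shiftWindow (hw : IsScalarOrbit (n + 1) p w) (m : ℕ) (i : Fin (n + 1)) :
    weierstrassUpdate p (shiftWindow w (n + 1) m i) i = w (m + (n + 1) + i) := by
  have hden : ∏ k : Fin n, (w (m + i) - w (m + i + (k + 1))) ≠ 0 :=
    Finset.prod_ne_zero_iff.2 fun k _ => sub_ne_zero.2 (hw.ne _ _ (by lia))
  have heq := hw.prod_eq (m + i)
  rw [Fin.prod_univ_castSucc] at heq
  simp only [Fin.val_castSucc, Fin.val_last] at heq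
  simp only [weierstrassUpdate, prod_univ_erase_eq_prod_add_succ, shiftWindow_self,
    shiftWindow_add_succ]
  rw [← heq, mul_div_cancel_left₀ _ hden, sub_sub_cancel, add_right_comm]

theorem gswStage_shiftWindow (hw : IsScalarOrbit (n + 1) p w) (m : ℕ) {k : ℕ} (hk : k ≤ n + 1) :
    gswStage p (shiftWindow w (n + 1) m 0) k = shiftWindow w (n + 1) m k := by
  induction k with
  | zero => rfl
  | succ k ih =>
    rw [gswStage, dif_pos (Nat.lt_of_succ_le hk), ih (Nat.le_of_succ_le hk),
      hw.weierstrassUpdate_shiftWindow m ⟨k, hk⟩, update_shiftWindow m ⟨k, hk⟩]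

theorem gswDefinedAt_shiftWindow (hw : IsScalarOrbit (n + 1) p w) (m : ℕ) :
    gswDefinedAt p (shiftWindow w (n + 1) m 0) := by
  intro i j hji
  obtain ⟨k, hk⟩ := Fin.exists_succ_eq.2 (sub_ne_zero.2 hji)
  obtain rfl : i + k.succ = j := by rw [hk, add_sub_cancel]
  rw [hw.gswStage_shiftWindow m i.2.le, shiftWindow_self, shiftWindow_add_succ]
  exact hw.ne _ _ (by lia)

theorem isGSWOrbit (hw : IsScalarOrbit (n + 1) p w) :
    IsGSWOrbit p fun k => shiftWindow w (n + 1) ((n + 1) * k) 0 := by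
  refine fun k => ⟨hw.gswDefinedAt_shiftWindow _, ?_⟩
  rw [gsw, hw.gswStage_shiftWindow _ le_rfl]
  ext j
  rw [shiftWindow_of_le le_rfl]
  simp [shiftWindow, mul_add_one]

end IsScalarOrbit

theorem IsEscapeRatio.exists_isGSWOrbit_tendsto {μ : ℂ}
    (hμ : IsEscapeRatio (n + 1) p.leadingCoeff μ) (hn : p.natDegree = n + 1) :
    ∃ z : ℕ → Fin (n + 1) → ℂ, IsGSWOrbit p z ∧
      ∀ i, Tendsto (fun k => z k i) atTop (Bornology.cobounded ℂ) := by
  obtain ⟨w, hw, hlim⟩ := hμ.exists_isScalarOrbit_tendsto hn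
  refine ⟨_, hw.isGSWOrbit, fun i => hlim.comp (tendsto_atTop_mono (fun k => ?_) tendsto_id)⟩
  exact (Nat.le_mul_of_pos_left k n.succ_pos).trans (Nat.le_add_right _ _)

end Sweep

theorem exists_mem_roots_norm_sub_mul_norm_eval_derivative_le {𝕜 : Type*} [NormedField 𝕜]
    {p : 𝕜[X]} (hp : p.Splits) (hdeg : p.natDegree ≠ 0) (z : 𝕜) :
    ∃ r ∈ p.roots, ‖z - r‖ * ‖p.derivative.eval z‖ ≤ p.natDegree * ‖p.eval z‖ := by
  classical
  have hcard := hp.natDegree_eq_card_roots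
  have hne : p.roots.toFinset.Nonempty := by
    rw [Multiset.toFinset_nonempty, ← Multiset.card_pos, ← hcard]
    exact Nat.pos_of_ne_zero hdeg
  obtain ⟨r, hr, hmin⟩ := p.roots.toFinset.exists_min_image (‖z - ·‖) hne
  simp only [Multiset.mem_toFinset] at hr hmin
  refine ⟨r, hr, ?_⟩
  rcases eq_or_ne z r with rfl | hzr
  · rw [sub_self, norm_zero, zero_mul]
    positivity
  have hzr' : 0 < ‖z - r‖ := norm_pos_iff.2 (sub_ne_zero.2 hzr)
  have hpz : p.eval z ≠ 0 := fun h => by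
    have hz : z ∈ p.roots := (mem_roots (ne_zero_of_natDegree_gt hdeg.bot_lt)).2 h
    exact hzr'.not_ge (by simpa using hmin z hz)
  rw [← div_le_iff₀ (norm_pos_iff.2 hpz), mul_div_assoc, ← norm_div, mul_comm, ← le_div_iff₀ hzr',
    hp.eval_derivative_div_eval_of_ne_zero hpz]
  calc ‖(p.roots.map fun s => 1 / (z - s)).sum‖
      ≤ (p.roots.map fun s => ‖1 / (z - s)‖).sum := by
        simpa using norm_multiset_sum_le (p.roots.map fun s => 1 / (z - s))
    _ ≤ p.roots.card • ‖z - r‖⁻¹ := by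
        rw [← Multiset.card_map fun s => ‖1 / (z - s)‖]
        refine Multiset.sum_le_card_nsmul _ _ ?_
        simp only [Multiset.mem_map, forall_exists_index, and_imp, forall_apply_eq_imp_iff₂,
          one_div, norm_inv]
        exact fun s hs => inv_anti₀ hzr' (hmin s hs)
    _ = p.natDegree / ‖z - r‖ := by rw [hcard, nsmul_eq_mul, div_eq_mul_inv]

theorem sum_norm_lt_norm_sum_sub_one {ι : Type*} {s : Finset ι} (hs : s.Nonempty) {c : ι → ℂ}
    (hc : ∀ i ∈ s, ‖c i‖ + (c i).re < 1) : ∑ i ∈ s, ‖c i‖ < ‖∑ i ∈ s, (c i - 1)‖ := by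
  calc ∑ i ∈ s, ‖c i‖ < ∑ i ∈ s, -(c i - 1).re := by
        refine Finset.sum_lt_sum_of_nonempty hs fun i hi => ?_
        rw [Complex.sub_re, Complex.one_re]
        linarith [hc i hi]
    _ = -(∑ i ∈ s, (c i - 1)).re := by rw [Finset.sum_neg_distrib, Complex.re_sum]
    _ ≤ ‖∑ i ∈ s, (c i - 1)‖ := (neg_le_abs _).trans (Complex.abs_re_le_norm _)

theorem norm_inv_add_re_inv_lt_one {d : ℂ} (hd : ‖d‖ + d.re < ‖d‖ ^ 2) :
    ‖d⁻¹‖ + (d⁻¹).re < 1 := by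
  have hd0 : 0 < ‖d‖ := norm_pos_iff.2 fun h => by simp [h] at hd
  have heq : ‖d⁻¹‖ + (d⁻¹).re = (‖d‖ + d.re) / ‖d‖ ^ 2 := by
    rw [norm_inv, Complex.inv_re, Complex.normSq_eq_norm_sq]
    field_simp
  rwa [heq, div_lt_one (pow_pos hd0 2)]

theorem norm_one_sub_add_re_lt_norm_sq {μ : ℂ} (hre : μ.re ∈ Set.Icc 1.29 1.31)
    (him : μ.im ∈ Set.Icc 0.355 0.375) :
    ‖1 - μ‖ + (1 - μ).re < ‖1 - μ‖ ^ 2 := by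
  obtain ⟨⟨hx, hx'⟩, hy, hy'⟩ := And.intro hre him
  have hsq : ‖1 - μ‖ ^ 2 - (1 - μ.re) ^ 2 = μ.im ^ 2 := by
    simpa using Complex.sq_norm_sub_sq_re (1 - μ)
  have hlt : ‖1 - μ‖ < 0.49 := lt_of_pow_lt_pow_left₀ 2 (by norm_num) (by nlinarith)
  rw [Complex.sub_re, Complex.one_re]
  nlinarith

theorem norm_one_sub_sq_add_re_lt_norm_sq {μ : ℂ} (hre : μ.re ∈ Set.Icc 1.29 1.31)
    (him : μ.im ∈ Set.Icc 0.355 0.375) :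
    ‖1 - μ ^ 2‖ + (1 - μ ^ 2).re < ‖1 - μ ^ 2‖ ^ 2 := by
  obtain ⟨⟨hx, hx'⟩, hy, hy'⟩ := And.intro hre him
  have hre₂ : (1 - μ ^ 2).re = 1 - (μ.re ^ 2 - μ.im ^ 2) := by simp [sq]
  have him₂ : (1 - μ ^ 2).im = -(2 * μ.re * μ.im) := by
    simp only [sq, Complex.sub_im, Complex.one_im, Complex.mul_im]
    ring
  have hre_lt : (1 - μ ^ 2).re < -0.5 := by nlinarith
  have him_lt : (1 - μ ^ 2).im < -0.9 := by nlinarith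
  have hnorm : 1 < ‖1 - μ ^ 2‖ := by
    refine lt_of_pow_lt_pow_left₀ 2 (norm_nonneg _) ?_
    nlinarith [Complex.sq_norm_sub_sq_re (1 - μ ^ 2)]
  linarith [lt_self_pow₀ hnorm one_lt_two]

theorem norm_one_sub_cube_add_re_lt_norm_sq {μ : ℂ} (hre : μ.re ∈ Set.Icc 1.29 1.31)
    (him : μ.im ∈ Set.Icc 0.355 0.375) :
    ‖1 - μ ^ 3‖ + (1 - μ ^ 3).re < ‖1 - μ ^ 3‖ ^ 2 := by
  obtain ⟨⟨hx, hx'⟩, hy, hy'⟩ := And.intro hre him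
  have hre₃ : (1 - μ ^ 3).re = 1 - μ.re * (μ.re ^ 2 - 3 * μ.im ^ 2) := by
    simp only [pow_succ, pow_zero, one_mul, Complex.sub_re, Complex.one_re, Complex.mul_re,
      Complex.mul_im]
    ring
  have him₃ : (1 - μ ^ 3).im = -(μ.im * (3 * μ.re ^ 2 - μ.im ^ 2)) := by
    simp only [pow_succ, pow_zero, one_mul, Complex.sub_im, Complex.one_im, Complex.mul_re,
      Complex.mul_im]
    ring
  have hre_lt : (1 - μ ^ 3).re < 0 := by nlinarith
  have him_lt : (1 - μ ^ 3).im < -1 := by nlinarith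
  have hnorm : 1 < ‖1 - μ ^ 3‖ :=
    (lt_neg_of_lt_neg him_lt).trans_le ((neg_le_abs _).trans (Complex.abs_im_le_norm _))
  linarith [lt_self_pow₀ hnorm one_lt_two]

-- The quintic is `(1 - (1 - μ) (1 - μ ^ 2) (1 - μ ^ 3)) / μ`.
theorem exists_quintic_eq_zero_re_mem_im_mem :
    ∃ μ : ℂ, μ ^ 5 - μ ^ 4 - μ ^ 3 + μ + 1 = 0 ∧
      μ.re ∈ Set.Icc 1.29 1.31 ∧ μ.im ∈ Set.Icc 0.355 0.375 := by
  set z : ℂ := ⟨1.3, 0.365⟩ with hz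
  set q : ℂ[X] := X ^ 5 - X ^ 4 - X ^ 3 + X + 1 with hq
  have hdeg : q.natDegree = 5 := by rw [hq]; compute_degree!
  have hqz : ‖q.eval z‖ ≤ 0.007 := by
    refine (Complex.norm_le_abs_re_add_abs_im _).trans ?_
    norm_num [hq, hz, pow_succ, abs_le]
  have hqz' : 4.7 ≤ ‖q.derivative.eval z‖ := by
    refine le_trans ?_ (Complex.abs_im_le_norm _)
    norm_num [hq, hz, pow_succ, abs_le]
  obtain ⟨μ, hμ, hle⟩ := exists_mem_roots_norm_sub_mul_norm_eval_derivative_le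
    (IsAlgClosed.splits q) (hdeg ▸ Nat.succ_ne_zero 4) z
  have hnear : ‖z - μ‖ ≤ 0.01 := by
    rw [hdeg, Nat.cast_ofNat] at hle
    nlinarith [norm_nonneg (z - μ)]
  obtain ⟨hre, hre'⟩ : -0.01 ≤ 1.3 - μ.re ∧ 1.3 - μ.re ≤ 0.01 :=
    abs_le.1 ((Complex.abs_re_le_norm (z - μ)).trans hnear)
  obtain ⟨him, him'⟩ : -0.01 ≤ 0.365 - μ.im ∧ 0.365 - μ.im ≤ 0.01 :=
    abs_le.1 ((Complex.abs_im_le_norm (z - μ)).trans hnear)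
  refine ⟨μ, by simpa [hq] using isRoot_of_mem_roots hμ, ?_, ?_⟩ <;> constructor <;> linarith

theorem exists_isEscapeRatio_three_one : ∃ μ : ℂ, IsEscapeRatio 3 1 μ := by
  obtain ⟨μ, hroot, hre, him⟩ := exists_quintic_eq_zero_re_mem_im_mem
  refine ⟨μ, ?_, ?_, ?_⟩
  · exact (by linarith [hre.1] : 1 < μ.re).trans_le (Complex.re_le_norm μ)
  · simp only [Fin.prod_univ_three, Fin.val_zero, Fin.val_one, Fin.val_two]
    linear_combination -μ * hroot
  · refine sum_norm_lt_norm_sum_sub_one Finset.univ_nonempty fun k _ =>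
      norm_inv_add_re_inv_lt_one ?_
    fin_cases k
    · simpa using norm_one_sub_add_re_lt_norm_sq hre him
    · exact norm_one_sub_sq_add_re_lt_norm_sq hre him
    · exact norm_one_sub_cube_add_re_lt_norm_sq hre him

theorem mainTheorem4_general (p : ℂ[X]) (hmonic : p.Monic) (hdeg : p.natDegree = 3) :
    ∃ z : ℕ → Fin 3 → ℂ, IsGSWOrbit p z ∧
      ∀ i : Fin 3, Tendsto (fun k : ℕ => z k i) atTop (Bornology.cobounded ℂ) := by
  obtain ⟨μ, hμ⟩ := exists_isEscapeRatio_three_one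
  rw [← hmonic.leadingCoeff] at hμ
  exact hμ.exists_isGSWOrbit_tendsto hdeg

theorem mainTheorem4 (p : ℂ[X]) (hmonic : p.Monic) (hdeg : p.natDegree = 3)
    (hroots : p.roots.Nodup) :
    ∃ z : ℕ → Fin 3 → ℂ, IsGSWOrbit p z ∧
      ∀ i : Fin 3, Filter.Tendsto (fun k : ℕ => z k i) Filter.atTop (Bornology.cobounded ℂ) :=
  mainTheorem4_general p hmonic hdeg
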